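/- Let $n\ge 1$, $X_n=\{0,\dots,n-1\}$ and $N\in\mathbb{N}$. An automaton $A$ over $X_n$ has a finite state set $Q_A$ and a transition function $\pi_A:X_n\times Q_A\to Q_A$, extended to words. It is synchronizing if for some $k$ each word $w$ of length $k$ forces a state (the state reached by reading $w$ does not depend on the initial state), and core if moreover each state is forced by a word of length at least $k$. Its underlying digraph $G_A$ has one edge $(p,x,\pi_A(x,p))$, labelled $x$, for all $p\in Q_A$, $x\in X_n$; automorphisms of $G_A$ need not preserve labels. For an automorphism $\phi$ of $G_A$, let $\mathscr{H}(A,\phi)$ be the transducer that in state $p$ on input $x$ outputs the label of the edge $(p,x,\pi_A(x,p))\phi$ and moves to $\pi_A(x,p)$. Let $\mathcal{H}_n$ be the group of (minimal, core) invertible transducers over $X_n$ that are synchronizing and have synchronizing inverse; each represents an automorphism of the one-sided shift $X_n^{-\mathbb{N}}$. A core synchronizing automaton $A$ is a support of $H\in\mathcal{H}_n$, realised by $\phi$, if $H$ and $\mathscr{H}(A,\phi)$ represent the same transformation of $X_n^{-\mathbb{N}}$ (such an $H$ has finite order). A circuit is a sequence of edges $(e_0,\dots,e_{k-1})$, $k\ge1$,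 such that the target of $e_i$ is the source of $e_{i+1}$ (indices modulo $k$); automorphisms act on circuits edgewise, and a rotated circuit is not identified with the original one. Let $A$ be an automaton, $\phi$ an automorphism of $G_A$ and $t\in Q_A$ a state with orbit of length $r$ under $\phi$. The state $t$ is heavy for $(A,\phi,N)$, with divisibility constant $b$, if $b$ is a proper divisor of $N$ with $r\mid b$ and $\operatorname{lcm}(b,\ell)=N$ for the orbit length $\ell$ of each edge into $t$. A number $M$ is then a valid splitting length if $M$ divides the orbit length of each edge into $t$, $\operatorname{lcm}(M,b)=N$, and $M=mr$ with $m>1$. To add shadow states along the orbit of the heavy state $t$ is to pass from $(A,\phi)$ to a pair $(A',\psi)$ of an automaton and an automorphism of $G_{A'}$ such that: * $Q_{A'}=Q_A\sqcup\{t_{a,i}: 1\le a<m,\ 0\le i<r\}$ (the $t_{a,i}$ being distinct), $t_{0,i}:=t\phi^i$ for $0\le i<r$, and $t\psi^{ar+i}=t_{a,i}$ for $0\le a<m$, $0\le i<r$, and $t\psi^{M}=t$; * $\pi_{A'}(x,s)=\pi_A(x,s)$ if $s\in Q_A$ and $\pi_A(x,s)$ is not in the orbit of $t$, and $\pi_{A'}(x,t_{a,i})=\pi_{A'}(x,t_{0,i})$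 for all $x,a,i$; * the map $\iota:Q_{A'}\to Q_A$ that is the identity on $Q_A$ and sends $t_{a,i}$ to $t_{0,i}$ satisfies $\iota(\pi_{A'}(x,q))=\pi_A(x,\iota(q))$, and the label-preserving graph homomorphism $G_{A'}\to G_A$ it induces intertwines $\psi$ and $\phi$ on states and on edges. Suppose that $A$ is a support of $H\in\mathcal{H}_n$ realised by $\phi_H$ and that every circuit of $A$ is on an orbit of length $N$ under $\phi_H$. Then: 1. By finitely many (possibly zero) successive additions of shadow states along orbits of heavy states (for the current automaton and automorphism and the given $N$, with valid splitting lengths), one can obtain from $(A,\phi_H)$ a pair $(\widehat A,\widehat\psi_H)$ such that $\widehat A$ is a support of $H$ realised by $\widehat\psi_H$ and every edge of $\widehat A$ is on an orbit of length $N$ under $\widehat\psi_H$. 2. One can also obtain in this way such a pair for which, in addition, every state of $\widehat A$ is on an orbit of length $N$ under $\widehat\psi_H$. -/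

import Mathlib

namespace ShiftAutomata

/-- A finite automaton over the alphabet `X_n = {0, ..., n-1}`: a finite set of states and a
transition function `π : X_n × Q → Q` (there are no initial or accepting states). -/
structure Automaton (n : ℕ) where
  State : Type
  finite_state : Finite State
  trans : Fin n → State → State

attribute [instance] Automaton.finite_state

namespace Automaton

variable {n : ℕ} (A : Automaton n)

/-- The state `π(w, q)` reached from `q` after reading the word `w` from left to right. -/
def read (q : A.State) (w : List (Fin n)) : A.State :=
  w.foldl (fun p x => A.trans x p) q

/-- The word `w` forces the state `q`: reading `w` from any state whatsoever ends in `q`. -/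
def Forces (w : List (Fin n)) (q : A.State) : Prop :=
  ∀ p, A.read p w = q

/-- Every word of length `k` forces a state. -/
def IsSyncAt (k : ℕ) : Prop :=
  ∀ w : List (Fin n), w.length = k → ∃ q, A.Forces w q

/-- Synchronizing at some level. -/
def IsSynchronizing : Prop :=
  ∃ k, A.IsSyncAt k

/-- Synchronizing and equal to its core: each state is in the image of the synchronizing map
on the words of length at least `k`, where `k` is a synchronizing level. -/
def IsCore : Prop :=
  ∃ k, A.IsSyncAt k ∧ ∀ q, ∃ w : List (Fin n), k ≤ w.length ∧ A.Forces w q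

/-- The edges of the underlying digraph `G_A`. For each state `p` and letter `x` there is exactly
one edge `(p, x, q)`, namely the one with `q = π(x, p)`; it is recorded as the pair `(p, x)`. -/
abbrev Edge : Type := A.State × Fin n

/-- Source of an edge. -/
def src (e : A.Edge) : A.State := e.1

/-- Label of an edge. -/
def label (e : A.Edge) : Fin n := e.2

/-- Target of an edge. -/
def tgt (e : A.Edge) : A.State := A.trans e.2 e.1

/-- `e_0, ..., e_k` is a (based) circuit of length `k + 1`: the target of `e_i` is the source of
`e_{i+1}`. Addition in `Fin (k + 1)` is modulo `k + 1`, so that `e_k` ends where `e_0` starts. -/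
def IsCircuit {k : ℕ} (e : Fin (k + 1) → A.Edge) : Prop :=
  ∀ i, A.tgt (e i) = A.src (e (i + 1))

/-- An automorphism of the unlabelled directed (multi)graph `G_A`: a permutation of the vertices
and a permutation of the edges that respect sources and targets. Labels need not be respected. -/
structure DigraphAut where
  state : Equiv.Perm A.State
  edge : Equiv.Perm A.Edge
  src_edge : ∀ e, A.src (edge e) = state (A.src e)
  tgt_edge : ∀ e, A.tgt (edge e) = state (A.tgt e)

namespace DigraphAut

variable {A} (φ : A.DigraphAut)

/-- Length of the orbit of a state. -/
noncomputable def stateOrbit (q : A.State) : ℕ :=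
  Function.minimalPeriod φ.state q

/-- Length of the orbit of an edge. -/
noncomputable def edgeOrbit (e : A.Edge) : ℕ :=
  Function.minimalPeriod φ.edge e

/-- Length of the orbit of a sequence of edges (such as a circuit) under the edgewise action; a
rotated circuit is not identified with the circuit itself. -/
noncomputable def seqOrbit {k : ℕ} (e : Fin (k + 1) → A.Edge) : ℕ :=
  Function.minimalPeriod (fun (c : Fin (k + 1) → A.Edge) i => φ.edge (c i)) e

end DigraphAut

end Automaton

/-- A (synchronous) transducer over `X_n`: an automaton with an output function
`X_n × Q → X_n`. -/
structure Transducer (n : ℕ) extends Automaton n where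
  out : Fin n → State → Fin n

namespace Transducer

variable {n : ℕ} (T : Transducer n)

/-- The state reached from `q` after reading the first `i` letters of `x ∈ X_n^ℕ`. -/
def stateAfter (q : T.State) (x : ℕ → Fin n) : ℕ → T.State
  | 0 => q
  | i + 1 => T.trans (x i) (stateAfter q x i)

/-- The map `X_n^ℕ → X_n^ℕ` induced by the transducer started in the state `q`. -/
def outFrom (q : T.State) (x : ℕ → Fin n) : ℕ → Fin n :=
  fun i => T.out (x i) (T.stateAfter q x i)

/-- No two distinct states are `ω`-equivalent (that is, induce the same map on `X_n^ℕ`). -/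
def IsMinimal : Prop :=
  ∀ p q : T.State, T.outFrom p = T.outFrom q → p = q

/-- Each state acts on the alphabet as a permutation. -/
def IsInvertible : Prop :=
  ∀ q : T.State, Function.Bijective (fun x => T.out x q)

/-- The inverse transducer: inputs and outputs of the transitions are exchanged. -/
noncomputable def inverse (h : T.IsInvertible) : Transducer n where
  State := T.State
  finite_state := T.finite_state
  trans := fun y q => T.trans ((Equiv.ofBijective _ (h q)).symm y) q
  out := fun y q => (Equiv.ofBijective _ (h q)).symm y

/-- The word `x_{-i-k} ... x_{-i-2} x_{-i-1}` of a point `x = ... x_{-2} x_{-1} x_0` of the shift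
space `X_n^{-ℕ}`. Such a point is encoded as the function `i ↦ x_{-i}` on `ℕ`. -/
def window (x : ℕ → Fin n) (i k : ℕ) : List (Fin n) :=
  ((List.range k).map (fun j => x (i + 1 + j))).reverse

/-- The synchronizing transducer `T` represents the transformation `f` of `X_n^{-ℕ}`: if
`y = f(x)` then `y_{-i}` is the letter that `T` writes when it reads `x_{-i}` in the state forced
by the `k` preceding letters `x_{-i-k} ... x_{-i-1}`, where `k` is a synchronizing level. -/
def Represents (f : (ℕ → Fin n) → (ℕ → Fin n)) : Prop :=
  ∃ k, T.IsSyncAt k ∧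
    ∀ x i, ∃ q, T.Forces (window x i k) q ∧ f x i = T.out (x i) q

end Transducer

/-- The elements of `𝓗_n` (which is isomorphic to the group of automorphisms of the one-sided
shift), each given by its minimal representative: minimal, invertible, core transducers that are
synchronizing and have a synchronizing inverse. -/
def Hn (n : ℕ) : Set (Transducer n) :=
  {T | T.IsMinimal ∧ T.IsCore ∧ ∃ h : T.IsInvertible, (T.inverse h).IsSynchronizing}

/-- The transducer `𝓗(A, φ)` that glues `A` to itself along the digraph automorphism `φ`: in the
state `p` it reads `x`, writes the label of `(p, x, π(x, p))φ` and moves to `π(x, p)`. -/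
def glue {n : ℕ} (A : Automaton n) (φ : A.DigraphAut) : Transducer n where
  toAutomaton := A
  out := fun x p => A.label (φ.edge (p, x))

/-- `A` is a support of `H` realised by `φ`: `A` is synchronizing and core, and `H` and `𝓗(A, φ)`
represent the same transformation of `X_n^{-ℕ}`. -/
def IsSupport {n : ℕ} (H : Transducer n) (A : Automaton n) (φ : A.DigraphAut) : Prop :=
  A.IsCore ∧ ∃ f, H.Represents f ∧ (glue A φ).Represents f

section Shadow

variable {n : ℕ}

/-- `b` is a divisibility constant for `t` with respect to `(A, φ, N)`: a proper divisor of `N`,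
divisible by the orbit length of `t`, whose least common multiple with the orbit length of any
edge into `t` is `N`. The state `t` is heavy for `(A, φ, N)` if it has such a constant. -/
def IsDivisibilityConstant {A : Automaton n} (φ : A.DigraphAut) (N : ℕ) (t : A.State) (b : ℕ) :
    Prop :=
  b ∈ N.properDivisors ∧ φ.stateOrbit t ∣ b ∧
    ∀ e : A.Edge, A.tgt e = t → Nat.lcm b (φ.edgeOrbit e) = N

/-- `M` is a valid splitting length for `t` with respect to the divisibility constant `b`. -/
def IsValidSplittingLength {A : Automaton n} (φ : A.DigraphAut) (N : ℕ) (t : A.State)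
    (b M : ℕ) : Prop :=
  (∀ e : A.Edge, A.tgt e = t → M ∣ φ.edgeOrbit e) ∧ Nat.lcm M b = N ∧
    ∃ m, 1 < m ∧ M = m * φ.stateOrbit t

/-- `(B, ψ)` is an in-split of `(A, φ)` along the orbit of `t` with orbit length `M`.
Here `r` is the length of the orbit of `t` under `φ`, the map `j` includes the states of `A` among
those of `B`, and `ι` sends each state of `B` to the state of `A` of which it is a copy. With
`l = a * r + i` and `0 ≤ i < r`, the state `t_{a,i}` is the `l`-th iterate of `j t` under `ψ`;
the shadow states are those with `a ≥ 1`, i.e. with `r ≤ l < M`. -/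
structure IsInSplit {A : Automaton n} (φ : A.DigraphAut) (t : A.State) (M : ℕ)
    {B : Automaton n} (ψ : B.DigraphAut) (j : A.State → B.State) (ι : B.State → A.State) :
    Prop where
  /-- The states of `A` are their own copies; in particular `j` is injective. -/
  proj_incl : ∀ s, ι (j s) = s
  /-- The original orbit of `t` is the beginning of the new one. -/
  orbit_old : ∀ l, l < φ.stateOrbit t → ψ.state^[l] (j t) = j (φ.state^[l] t)
  /-- The shadow states are new. -/
  orbit_new : ∀ l, φ.stateOrbit t ≤ l → l < M → ψ.state^[l] (j t) ∉ Set.range j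
  /-- The new orbit of `t` has length `M`; in particular the shadow states are distinct. -/
  orbit_length : ψ.stateOrbit (j t) = M
  /-- There are no states besides those of `A` and the shadow states. -/
  state_cases : ∀ q, q ∈ Set.range j ∨
    ∃ l, φ.stateOrbit t ≤ l ∧ l < M ∧ q = ψ.state^[l] (j t)
  /-- Transitions that do not end on the orbit of `t` are unchanged. -/
  trans_old : ∀ x s, (∀ l : ℕ, A.trans x s ≠ φ.state^[l] t) →
    B.trans x (j s) = j (A.trans x s)
  /-- All copies of a state have the same outgoing transitions. -/
  trans_copy : ∀ x q, B.trans x q = B.trans x (j (ι q))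
  /-- `B` folds onto `A` through `ι`. -/
  proj_trans : ∀ x q, ι (B.trans x q) = A.trans x (ι q)
  /-- `ι` intertwines `ψ` and `φ` on states. -/
  proj_state : ∀ q, ι (ψ.state q) = φ.state (ι q)
  /-- `ι`, which keeps labels, intertwines `ψ` and `φ` on edges. -/
  proj_edge : ∀ e : B.Edge,
    ((ι (ψ.edge e).1, (ψ.edge e).2) : A.Edge) = φ.edge (ι e.1, e.2)

/-- One step of adding shadow states: `(B, ψ)` is obtained from `(A, φ)` by an in-split along the
orbit of a heavy state `t` with a valid splitting length `M`. -/
def AddsShadowStates (N : ℕ) (P P₁ : Σ A : Automaton n, A.DigraphAut) : Prop :=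
  ∃ (t : P.1.State) (b M : ℕ) (j : P.1.State → P₁.1.State) (ι : P₁.1.State → P.1.State),
    IsDivisibilityConstant P.2 N t b ∧ IsValidSplittingLength P.2 N t b M ∧
      IsInSplit P.2 t M P₁.2 j ι

end Shadow

end ShiftAutomata

open ShiftAutomata

/-! The orbit length of a circuit is the lcm of the orbit lengths of its edges, and in a core
automaton each edge lies on a circuit. So all edge orbit lengths divide `N`, and an edge has the
wrong length exactly when its length divides `N / p` for some prime `p` dividing `N`; call it bad
for `p`.

Fix `p`. Bad edges contain no circuit, so some bad edge `e` has no bad edge entering its source `t`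
(`exists_edge_forall_pred`). Then `t` is heavy with constant `N / p`, and the lcm of its orbit
length with the full power of `p` in `N` is a valid splitting length `M` (`isHeavy_of_src`). The
split exists because the edges entering the orbit can be distributed equivariantly over `M` copies
(`exists_isInSplit`). In the split, the orbit length of an edge is the lcm of those of its source
and of its projection (`edgeOrbit_eq`). Hence no edge leaving the new orbit is bad, the other bad
edges inject into the old ones without hitting `e`, and no edge becomes bad for a prime already
treated.

Once all edges have length `N`, a state of orbit length `r ≠ N` is heavy with constant `r` and can
be split to length `N` directly. -/

namespace ShiftAutomata

/-! ### Paths and circuits in core automata -/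

namespace Automaton

variable {n : ℕ} {A : Automaton n}

theorem read_append (q : A.State) (v w : List (Fin n)) :
    A.read q (v ++ w) = A.read (A.read q v) w := by
  simp [read]

/-- In a core automaton each state can be reached from each state. -/
theorem IsCore.exists_read_eq (h : A.IsCore) (p q : A.State) : ∃ w, A.read p w = q := by
  obtain ⟨k, -, h⟩ := h
  obtain ⟨w, -, hw⟩ := h q
  exact ⟨w, hw p⟩

theorem IsCore.exists_tgt_eq (hn : 0 < n) (h : A.IsCore) (q : A.State) :
    ∃ e : A.Edge, A.tgt e = q := by
  obtain ⟨w, hw⟩ := h.exists_read_eq (A.trans ⟨0, hn⟩ q) q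
  rcases List.eq_nil_or_concat w with rfl | ⟨v, x, rfl⟩
  · exact ⟨(q, ⟨0, hn⟩), hw⟩
  · refine ⟨(A.read (A.trans ⟨0, hn⟩ q) v, x), ?_⟩
    rw [List.concat_eq_append, read_append] at hw
    exact hw

/-- In a core automaton each edge lies on a circuit. -/
theorem IsCore.exists_circuit (h : A.IsCore) (e : A.Edge) :
    ∃ (k : ℕ) (c : Fin (k + 1) → A.Edge), A.IsCircuit c ∧ c 0 = e := by
  obtain ⟨p, x⟩ := e
  obtain ⟨w, hw⟩ := h.exists_read_eq (A.trans x p) p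
  refine ⟨w.length, fun i => (A.read p ((x :: w).take i), (x :: w)[(i : ℕ)]'(by have := i.2; simp; omega)), ?_, ?_⟩
  · intro i
    have hi : A.tgt (A.read p ((x :: w).take i), (x :: w)[(i : ℕ)]'(by have := i.2; simp; omega)) =
        A.read p ((x :: w).take (i + 1)) := by
      rw [← List.take_concat_get' _ _ (by have := i.2; simp; omega), read_append]
      rfl
    rw [hi]
    rcases Fin.eq_castSucc_or_eq_last i with ⟨i, rfl⟩ | rfl
    · simp [src]
    · simpa [src, read] using hw
  · simp [read]

/-! ### Orbit lengths under a digraph automorphism -/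

namespace DigraphAut

variable (φ : A.DigraphAut)

theorem edge_iterate_fst (k : ℕ) (e : A.Edge) : (φ.edge^[k] e).1 = φ.state^[k] e.1 := by
  induction k with
  | zero => rfl
  | succ k ih =>
    rw [Function.iterate_succ_apply', Function.iterate_succ_apply', ← ih]
    exact φ.src_edge _

theorem tgt_edge_iterate (k : ℕ) (e : A.Edge) :
    A.tgt (φ.edge^[k] e) = φ.state^[k] (A.tgt e) := by
  induction k with
  | zero => rfl
  | succ k ih =>
    rw [Function.iterate_succ_apply', Function.iterate_succ_apply', ← ih]
    exact φ.tgt_edge _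

theorem stateOrbit_dvd_iff {q : A.State} {m : ℕ} :
    φ.stateOrbit q ∣ m ↔ φ.state^[m] q = q :=
  Function.isPeriodicPt_iff_minimalPeriod_dvd.symm

theorem edgeOrbit_dvd_iff {e : A.Edge} {m : ℕ} :
    φ.edgeOrbit e ∣ m ↔ φ.edge^[m] e = e :=
  Function.isPeriodicPt_iff_minimalPeriod_dvd.symm

theorem stateOrbit_pos (q : A.State) : 0 < φ.stateOrbit q :=
  Function.minimalPeriod_pos_of_mem_periodicPts (φ.state.injective.mem_periodicPts q)

theorem stateOrbit_src_dvd (e : A.Edge) : φ.stateOrbit (A.src e) ∣ φ.edgeOrbit e := by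
  rw [stateOrbit_dvd_iff]
  exact (φ.edge_iterate_fst _ e).symm.trans
    (congrArg Prod.fst (φ.edgeOrbit_dvd_iff.1 dvd_rfl))

theorem stateOrbit_tgt_dvd (e : A.Edge) : φ.stateOrbit (A.tgt e) ∣ φ.edgeOrbit e := by
  rw [stateOrbit_dvd_iff]
  exact (φ.tgt_edge_iterate _ e).symm.trans
    (congrArg A.tgt (φ.edgeOrbit_dvd_iff.1 dvd_rfl))

/-- The action is coordinatewise, so the orbit length of a sequence is the lcm of those of its
edges. -/
theorem seqOrbit_dvd_iff {k : ℕ} {c : Fin (k + 1) → A.Edge} {m : ℕ} :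
    φ.seqOrbit c ∣ m ↔ ∀ i, φ.edgeOrbit (c i) ∣ m := by
  have h : ∀ i, (fun (c : Fin (k + 1) → A.Edge) i => φ.edge (c i))^[m] c i =
      φ.edge^[m] (c i) := by
    intro i
    induction m with
    | zero => rfl
    | succ m ih => rw [Function.iterate_succ_apply', Function.iterate_succ_apply', ← ih]
  rw [seqOrbit, ← Function.isPeriodicPt_iff_minimalPeriod_dvd, Function.IsPeriodicPt,
    Function.IsFixedPt, funext_iff]
  simp only [h, edgeOrbit_dvd_iff]

theorem seqOrbit_pos {k : ℕ} (c : Fin (k + 1) → A.Edge) : 0 < φ.seqOrbit c := by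
  refine Function.minimalPeriod_pos_of_mem_periodicPts (Function.Injective.mem_periodicPts ?_ c)
  intro c d h
  exact funext fun i => φ.edge.injective (congrFun h i)

/-- If all orbits of circuits have length `N`, the edges whose orbit length divides a fixed proper
divisor of `N` contain no circuit, so one of them is preceded by no other. -/
theorem exists_edge_forall_pred {N b : ℕ}
    (hcirc : ∀ (k : ℕ) (c : Fin (k + 1) → A.Edge), A.IsCircuit c → φ.seqOrbit c = N)
    (hb : ¬ N ∣ b) (hne : ∃ e, φ.edgeOrbit e ∣ b) :
    ∃ e, φ.edgeOrbit e ∣ b ∧ ∀ e', A.tgt e' = A.src e → ¬ φ.edgeOrbit e' ∣ b := by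
  by_contra! hcon
  choose g hg hgb using fun e : {e // φ.edgeOrbit e ∣ b} => hcon e.1 e.2
  let G : {e // φ.edgeOrbit e ∣ b} → {e // φ.edgeOrbit e ∣ b} := fun e => ⟨g e, hgb e⟩
  have hG : ∀ e, A.tgt (G e).1 = A.src e.1 := hg
  obtain ⟨e, he⟩ := hne
  obtain ⟨u, v, huv, h⟩ := Finite.exists_ne_map_eq_of_infinite fun k : ℕ => G^[k] ⟨e, he⟩
  wlog hlt : u < v generalizing u v
  · exact this v u huv.symm h.symm (by omega)
  obtain ⟨k, rfl⟩ : ∃ k, v = (k + 1) + u := ⟨v - u - 1, by omega⟩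
  simp only [Function.iterate_add_apply G (k + 1) u] at h
  generalize G^[u] ⟨e, he⟩ = d at h
  -- `G` picks predecessors, so its cycle runs backwards; the exponent `k - i` reverses it into a
  -- circuit.
  let c : Fin (k + 1) → A.Edge := fun i => (G^[k - i] d).1
  have hc : A.IsCircuit c := by
    intro i
    rcases Fin.eq_castSucc_or_eq_last i with ⟨i, rfl⟩ | rfl
    · have hi : k - (i : ℕ) = (k - (i + 1)) + 1 := by omega
      simp only [c, Fin.val_castSucc, Fin.coeSucc_eq_succ, Fin.val_succ]
      rw [hi, Function.iterate_succ_apply', hG]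
    · simp only [c, Fin.val_last, Fin.last_add_one, Fin.val_zero, Nat.sub_self, Nat.sub_zero]
      conv_lhs => rw [Function.iterate_zero_apply, h, Function.iterate_succ_apply']
      exact hG _
  refine hb ?_
  rw [← hcirc k c hc, seqOrbit_dvd_iff]
  exact fun i => (G^[k - i] d).2

end DigraphAut

end Automaton

/-! ### What an in-split inherits -/

theorem Transducer.window_succ {n : ℕ} (x : ℕ → Fin n) (i k : ℕ) :
    Transducer.window x i (k + 1) = x (i + 1 + k) :: Transducer.window x i k := by
  simp [Transducer.window, List.range_succ]

namespace IsInSplit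

variable {n : ℕ} {A B : Automaton n} {φ : A.DigraphAut} {t : A.State} {M : ℕ}
  {ψ : B.DigraphAut} {j : A.State → B.State} {ι : B.State → A.State}

theorem proj_state_iterate (h : IsInSplit φ t M ψ j ι) (k : ℕ) (q : B.State) :
    ι (ψ.state^[k] q) = φ.state^[k] (ι q) :=
  (Function.Semiconj.iterate_right (show Function.Semiconj ι ψ.state φ.state from h.proj_state) k) q

theorem proj_edge_iterate (h : IsInSplit φ t M ψ j ι) (k : ℕ) (e : B.Edge) :
    ((ι (ψ.edge^[k] e).1, (ψ.edge^[k] e).2) : A.Edge) = φ.edge^[k] (ι e.1, e.2) :=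
  (Function.Semiconj.iterate_right
    (show Function.Semiconj (fun e : B.Edge => ((ι e.1, e.2) : A.Edge)) ψ.edge φ.edge
      from h.proj_edge) k) e

theorem stateOrbit_iterate (h : IsInSplit φ t M ψ j ι) (l : ℕ) :
    ψ.stateOrbit (ψ.state^[l] (j t)) = M := by
  rw [← h.orbit_length]
  exact Function.minimalPeriod_apply_iterate (ψ.state.injective.mem_periodicPts _) l

theorem mem_orbit_or (h : IsInSplit φ t M ψ j ι) (q : B.State) :
    (∃ l, q = ψ.state^[l] (j t)) ∨ (q = j (ι q) ∧ ∀ l : ℕ, ι q ≠ φ.state^[l] t) := by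
  rcases h.state_cases q with ⟨s, rfl⟩ | ⟨l, -, -, rfl⟩
  · rw [h.proj_incl]
    by_cases hs : ∃ l : ℕ, s = φ.state^[l] t
    · left
      obtain ⟨l, rfl⟩ := hs
      refine ⟨l % φ.stateOrbit t, ?_⟩
      rw [h.orbit_old _ (Nat.mod_lt _ (φ.stateOrbit_pos t))]
      exact congrArg j Function.iterate_mod_minimalPeriod_eq.symm
    · push Not at hs
      exact Or.inr ⟨rfl, hs⟩
  · exact Or.inl ⟨l, rfl⟩

/-- Off the new orbit, `ι` is injective and commutes with the automorphisms, so orbit lengths there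
do not change. -/
theorem stateOrbit_cases (h : IsInSplit φ t M ψ j ι) (q : B.State) :
    ψ.stateOrbit q = M ∨
      (q = j (ι q) ∧ ι q ≠ t ∧ ψ.stateOrbit q = φ.stateOrbit (ι q)) := by
  rcases h.mem_orbit_or q with ⟨l, rfl⟩ | ⟨hq, hι⟩
  · exact Or.inl (h.stateOrbit_iterate l)
  · refine Or.inr ⟨hq, hι 0, Nat.dvd_antisymm ?_ ?_⟩
    · rw [ψ.stateOrbit_dvd_iff]
      have h1 : ι (ψ.state^[φ.stateOrbit (ι q)] q) = ι q := by
        rw [h.proj_state_iterate, ← φ.stateOrbit_dvd_iff]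
      rcases h.mem_orbit_or (ψ.state^[φ.stateOrbit (ι q)] q) with ⟨l, hl⟩ | ⟨h2, -⟩
      · refine absurd ?_ (hι l)
        rw [← h1, hl, h.proj_state_iterate, h.proj_incl]
      · rw [h2, h1, ← hq]
    · rw [φ.stateOrbit_dvd_iff, ← h.proj_state_iterate, ψ.stateOrbit_dvd_iff.1 dvd_rfl]

/-- An edge is its source together with its label, and the label moves as that of the projected edge
does. So a power of `ψ` fixes an edge iff it fixes its source and its projection. -/
theorem edgeOrbit_eq (h : IsInSplit φ t M ψ j ι) (e : B.Edge) :
    ψ.edgeOrbit e = Nat.lcm (ψ.stateOrbit e.1) (φ.edgeOrbit (ι e.1, e.2)) := by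
  refine Nat.dvd_antisymm ?_ (Nat.lcm_dvd (ψ.stateOrbit_src_dvd e) ?_)
  · rw [ψ.edgeOrbit_dvd_iff]
    refine Prod.ext ?_ ?_
    · rw [ψ.edge_iterate_fst, ← ψ.stateOrbit_dvd_iff]
      exact Nat.dvd_lcm_left _ _
    · refine (congrArg Prod.snd (h.proj_edge_iterate _ e)).trans ?_
      rw [φ.edgeOrbit_dvd_iff.1 (Nat.dvd_lcm_right _ _)]
  · rw [φ.edgeOrbit_dvd_iff, ← h.proj_edge_iterate, ψ.edgeOrbit_dvd_iff.1 dvd_rfl]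

theorem proj_read (h : IsInSplit φ t M ψ j ι) (q : B.State) (w : List (Fin n)) :
    ι (B.read q w) = A.read (ι q) w := by
  induction w generalizing q with
  | nil => rfl
  | cons x w ih => exact (ih _).trans (congrArg (fun p => A.read p w) (h.proj_trans x q))

/-- After `w` only the copy of `s` is unknown; all copies have the same outgoing transitions, so one
more letter settles the state. This is why the synchronizing level grows by one. -/
theorem forces_concat (h : IsInSplit φ t M ψ j ι) {w : List (Fin n)} {s : A.State}
    (hw : A.Forces w s) (x : Fin n) : B.Forces (w ++ [x]) (B.trans x (j s)) := by
  intro p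
  rw [Automaton.read_append]
  refine (h.trans_copy x (B.read p w)).trans ?_
  rw [h.proj_read, hw]

theorem forces_proj (h : IsInSplit φ t M ψ j ι) {w : List (Fin n)} {q : B.State}
    (hw : B.Forces w q) : A.Forces w (ι q) := by
  intro p
  rw [← hw (j p), h.proj_read, h.proj_incl]

theorem isSyncAt (h : IsInSplit φ t M ψ j ι) {k : ℕ} (hk : A.IsSyncAt k) :
    B.IsSyncAt (k + 1) := by
  intro w hw
  rcases List.eq_nil_or_concat w with rfl | ⟨v, x, rfl⟩
  · simp at hw
  · obtain ⟨s, hs⟩ := hk v (by simpa using hw)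
    rw [List.concat_eq_append]
    exact ⟨_, h.forces_concat hs x⟩

theorem exists_tgt_eq (hn : 0 < n) (hA : A.IsCore) (h : IsInSplit φ t M ψ j ι) (q : B.State) :
    ∃ e : B.Edge, B.tgt e = q := by
  have key : ∀ l, ∃ e : B.Edge, B.tgt e = ψ.state^[l] (j t) := by
    obtain ⟨e, he⟩ := hA.exists_tgt_eq hn t
    have h0 : ∃ d : B.Edge, B.tgt d = j t := by
      have h1 : ι (B.trans e.2 (j e.1)) = t := by
        rw [h.proj_trans, h.proj_incl]; exact he
      rcases h.mem_orbit_or (B.trans e.2 (j e.1)) with ⟨l, hl⟩ | ⟨-, h2⟩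
      -- The lifted edge ends `l` steps along the orbit of `j t`; this exponent completes `l` full
      -- turns.
      · refine ⟨ψ.edge^[ψ.stateOrbit (j t) * l - l] (j e.1, e.2), ?_⟩
        rw [ψ.tgt_edge_iterate]
        refine (congrArg _ hl).trans ?_
        rw [← Function.iterate_add_apply, Nat.sub_add_cancel
          (Nat.le_mul_of_pos_left _ (ψ.stateOrbit_pos _)), ← ψ.stateOrbit_dvd_iff]
        exact Nat.dvd_mul_right _ _
      · exact absurd h1 (h2 0)
    obtain ⟨d, hd⟩ := h0
    exact fun l => ⟨ψ.edge^[l] d, by rw [ψ.tgt_edge_iterate, hd]⟩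
  rcases h.mem_orbit_or q with ⟨l, rfl⟩ | ⟨hq, hι⟩
  · exact key l
  · obtain ⟨e, he⟩ := hA.exists_tgt_eq hn (ι q)
    refine ⟨(j e.1, e.2), ?_⟩
    have he' : A.trans e.2 e.1 = ι q := he
    rw [hq, ← he']
    exact h.trans_old e.2 e.1 fun l => he' ▸ hι l

theorem isCore (hn : 0 < n) (hA : A.IsCore) (h : IsInSplit φ t M ψ j ι) : B.IsCore := by
  obtain ⟨k, hk, hf⟩ := id hA
  refine ⟨k + 1, h.isSyncAt hk, fun q => ?_⟩
  obtain ⟨⟨p, x⟩, hp⟩ := h.exists_tgt_eq hn hA q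
  obtain ⟨w, hw, hws⟩ := hf (ι p)
  have hq : B.trans x (j (ι p)) = q := by rw [← h.trans_copy]; exact hp
  exact ⟨w ++ [x], by simpa using hw, hq ▸ h.forces_concat hws x⟩

/-- Lengthening the window by one earlier letter leaves the state forced in `A` unchanged, and
`proj_edge` makes the output at a copy equal to that at the original. -/
theorem represents (h : IsInSplit φ t M ψ j ι) {f : (ℕ → Fin n) → (ℕ → Fin n)}
    (hf : (glue A φ).Represents f) : (glue B ψ).Represents f := by
  obtain ⟨k, hk, hf⟩ := hf
  refine ⟨k + 1, h.isSyncAt hk, fun x i => ?_⟩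
  obtain ⟨s, hs, hfs⟩ := hf x i
  obtain ⟨q, hq⟩ := h.isSyncAt hk (Transducer.window x i (k + 1)) (by simp [Transducer.window])
  refine ⟨q, hq, hfs.trans ?_⟩
  have hsq : ι q = s := by
    rw [← h.forces_proj hq s, Transducer.window_succ]
    exact hs _
  subst hsq
  exact (congrArg Prod.snd (h.proj_edge (q, x i))).symm

theorem isSupport (hn : 0 < n) {H : Transducer n} (hA : IsSupport H A φ)
    (h : IsInSplit φ t M ψ j ι) : IsSupport H B ψ := by
  obtain ⟨hc, f, hH, hf⟩ := hA
  exact ⟨h.isCore hn hc, f, hH, h.represents hf⟩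

end IsInSplit

/-! ### Construction of in-splits -/

/-- If the points satisfying `P` are fixed only by powers of `σ` with exponent divisible by `M`,
the points in their `σ`-orbits can be indexed modulo `M`, equivariantly and with the index of each
point counted from a point satisfying `P`. -/
theorem exists_equivariant_index {X : Type*} (σ : Equiv.Perm X) (P : X → Prop) (M : ℕ)
    (hP : ∀ x, P x → ∀ k : ℤ, (σ ^ k) x = x → (M : ℤ) ∣ k) :
    ∃ T : X → ZMod M, ∀ x, (∃ y, P y ∧ σ.SameCycle y x) →
      T (σ x) = T x + 1 ∧ ∃ (y : X) (k : ℤ), P y ∧ (σ ^ k) y = x ∧ T x = k := by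
  -- The predicate depends only on the cycle of `x`, so `epsilon` chooses the same base point along
  -- a whole cycle. The exponent from that base point is then well defined modulo `M` by `hP`.
  let rep : X → X := fun x => @Classical.epsilon X ⟨x⟩ fun y => P y ∧ σ.SameCycle y x
  let κ : X → ℤ := fun x => Classical.epsilon fun k : ℤ => (σ ^ k) (rep x) = x
  have hrep : ∀ x, (∃ y, P y ∧ σ.SameCycle y x) → P (rep x) ∧ (σ ^ κ x) (rep x) = x := by
    intro x hx
    have h := Classical.epsilon_spec hx
    exact ⟨h.1, Classical.epsilon_spec (p := fun k : ℤ => (σ ^ k) (rep x) = x) h.2⟩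
  refine ⟨fun x => κ x, fun x hx => ⟨?_, rep x, κ x, (hrep x hx).1, (hrep x hx).2, rfl⟩⟩
  have hσ : rep (σ x) = rep x := by
    have : (fun y => P y ∧ σ.SameCycle y (σ x)) = fun y => P y ∧ σ.SameCycle y x := by
      simp only [Equiv.Perm.sameCycle_apply_right]
    simp only [rep, this]
  have h1 := hrep x hx
  have h2 := hrep (σ x) (by simpa only [Equiv.Perm.sameCycle_apply_right] using hx)
  rw [hσ] at h2
  have h3 : (σ ^ (κ x + 1 - κ (σ x))) (rep x) = rep x := by
    rw [sub_eq_neg_add, zpow_add, Equiv.Perm.mul_apply, zpow_neg, Equiv.Perm.inv_eq_iff_eq, h2.2,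
      add_comm, zpow_add, Equiv.Perm.mul_apply, h1.2, zpow_one]
  have h4 := hP _ h1.1 _ h3
  have h5 := (ZMod.intCast_eq_intCast_iff_dvd_sub (κ (σ x)) (κ x + 1) M).2 h4
  simpa using h5

variable {n : ℕ} {A : Automaton n}

/-- The automaton with state set `S` in which `F` prescribes the targets of the lifts along
`ι` of the edges of `A`. -/
def coverAutomaton {S : Type} [Finite S] (ι : S → A.State) (F : A.Edge → S) : Automaton n where
  State := S
  finite_state := inferInstance
  trans x q := F (ι q, x)

/-- The lift of an automorphism `φ` of `A` to `coverAutomaton ι F`, with given action on states. -/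
noncomputable def coverAut {S : Type} [Finite S] {ι : S → A.State} {F : A.Edge → S}
    (φ : A.DigraphAut) (σ : Equiv.Perm S) (hσ : ∀ q, ι (σ q) = φ.state (ι q))
    (hF : ∀ e, F (φ.edge e) = σ (F e)) : (coverAutomaton ι F).DigraphAut where
  state := σ
  edge := Equiv.ofBijective
    (fun e : S × Fin n => ((σ e.1, (φ.edge (ι e.1, e.2)).2) : S × Fin n)) <| by
      refine Finite.injective_iff_bijective.1 ?_
      rintro ⟨p, x⟩ ⟨q, y⟩ h
      obtain rfl : p = q := σ.injective (congrArg Prod.fst h)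
      have h1 : φ.edge (ι p, x) = φ.edge (ι p, y) :=
        Prod.ext ((φ.src_edge (ι p, x)).trans (φ.src_edge (ι p, y)).symm) (Prod.mk.inj h).2
      have h2 := φ.edge.injective h1
      rw [Prod.mk.injEq] at h2
      rw [h2.2]
  src_edge _ := rfl
  tgt_edge e := by
    change F (ι (σ e.1), (φ.edge (ι e.1, e.2)).2) = σ (F (ι e.1, e.2))
    rw [← hF]
    exact congrArg F (Prod.ext ((hσ e.1).trans (φ.src_edge (ι e.1, e.2)).symm) rfl)

/-- The orbit of a state can be blown up to any multiple `M` of its length that divides the orbit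
lengths of the edges into that state. -/
theorem exists_isInSplit (φ : A.DigraphAut) (t : A.State) {M : ℕ} (hM : 0 < M)
    (hr : φ.stateOrbit t ∣ M) (he : ∀ e, A.tgt e = t → M ∣ φ.edgeOrbit e) :
    ∃ (B : Automaton n) (ψ : B.DigraphAut) (j : A.State → B.State) (ι : B.State → A.State),
      IsInSplit φ t M ψ j ι := by
  classical
  have : NeZero M := ⟨hM.ne'⟩
  set r := φ.stateOrbit t with hr_def
  have hrpos : 0 < r := φ.stateOrbit_pos t
  have hrM : r ≤ M := Nat.le_of_dvd hM hr
  have hmod : ∀ l, φ.state^[l % r] t = φ.state^[l] t := fun l =>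
    Function.iterate_mod_minimalPeriod_eq
  have hinj : ∀ k l, k < r → l < r → φ.state^[k] t = φ.state^[l] t → k = l := fun k l hk hl h =>
    (Function.iterate_eq_iterate_iff_of_lt_minimalPeriod hk hl).1 h
  -- The projection of the new orbit, which winds `M / r` times around the old one; it is
  -- equivariant because `r` divides `M`.
  let γ : ZMod M → A.State := fun a => φ.state^[a.val] t
  have hγnat : ∀ l : ℕ, γ l = φ.state^[l] t := by
    intro l
    simp only [γ]
    rw [ZMod.val_natCast, ← hmod, Nat.mod_mod_of_dvd _ hr, hmod]
  have hγsucc : ∀ a, γ (a + 1) = φ.state (γ a) := by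
    intro a
    have := hγnat (a.val + 1)
    rw [Nat.cast_succ, ZMod.natCast_zmod_val] at this
    rw [this, Function.iterate_succ_apply']
  have hγint : ∀ k : ℤ, γ k = (φ.state ^ k) t := by
    intro k
    induction k using Int.induction_on with
    | zero => simpa using hγnat 0
    | succ k ih =>
      rw [Int.cast_add, Int.cast_one, hγsucc, ih, add_comm, zpow_add, Equiv.Perm.mul_apply,
        zpow_one]
    | pred k ih =>
      apply φ.state.injective
      rw [← hγsucc, Int.cast_sub, Int.cast_one, sub_add_cancel, ih]
      conv_rhs => rw [← Equiv.Perm.mul_apply, ← zpow_one_add]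
      congr 2
      ring
  have hmem : ∀ s, φ.state s ∈ Set.range γ ↔ s ∈ Set.range γ := by
    intro s
    constructor
    · rintro ⟨a, ha⟩
      refine ⟨a - 1, φ.state.injective ?_⟩
      rw [← hγsucc, sub_add_cancel, ha]
    · rintro ⟨a, rfl⟩
      exact ⟨a + 1, hγsucc a⟩
  -- `T e` decides which copy the edge `e` enters. Equivariance is possible because `M` divides the
  -- orbit length of each edge into `t`.
  obtain ⟨T, hT⟩ := exists_equivariant_index φ.edge (fun e => A.tgt e = t) M (by
    intro e het k hk
    have h1 : (φ.edgeOrbit e : ℤ) ∣ k :=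
      (MulAction.zpow_smul_eq_iff_minimalPeriod_dvd (a := φ.edge) (b := e)).1 hk
    exact (Int.natCast_dvd_natCast.2 (he e het)).trans h1)
  have htgt : ∀ (k : ℤ) e, A.tgt ((φ.edge ^ k) e) = (φ.state ^ k) (A.tgt e) := by
    intro k e
    induction k using Int.induction_on with
    | zero => rfl
    | succ k ih =>
      rw [add_comm, zpow_add, zpow_add, Equiv.Perm.mul_apply, Equiv.Perm.mul_apply, ← ih]
      exact φ.tgt_edge _
    | pred k ih =>
      apply φ.state.injective
      rw [← φ.tgt_edge, ← Equiv.Perm.mul_apply, ← Equiv.Perm.mul_apply, ← zpow_one_add,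
        ← zpow_one_add, add_sub_cancel, ih]
  have hcyc : ∀ e, A.tgt e ∈ Set.range γ → ∃ y, A.tgt y = t ∧ φ.edge.SameCycle y e := by
    rintro e ⟨a, ha⟩
    refine ⟨(φ.edge ^ (-(a.val : ℤ))) e, ?_, (a.val : ℤ), ?_⟩
    · rw [htgt, zpow_neg, Equiv.Perm.inv_eq_iff_eq, ← ha, ← hγint, Int.cast_natCast,
        ZMod.natCast_zmod_val]
    · simp
  have hγT : ∀ e, A.tgt e ∈ Set.range γ → γ (T e) = A.tgt e := by
    intro e hme
    obtain ⟨y, k, hy, hk, hTk⟩ := (hT e (hcyc e hme)).2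
    rw [hTk, hγint, ← hk, htgt, hy]
  let S : Type := {s : A.State // s ∉ Set.range γ} ⊕ ZMod M
  let ι : S → A.State := Sum.elim Subtype.val γ
  let σ : Equiv.Perm S := Equiv.sumCongr
    (φ.state.subtypeEquiv fun s => (not_congr (hmem s)).symm) (Equiv.addRight 1)
  let F : A.Edge → S := fun e =>
    if h : A.tgt e ∈ Set.range γ then .inr (T e) else .inl ⟨A.tgt e, h⟩
  -- Any index over `s` will do: reduced modulo `r` it becomes the unique one below `r`, that is,
  -- the copy with `a = 0`.
  let j : A.State → S := fun s =>
    if h : s ∈ Set.range γ then .inr ((h.choose.val % r : ℕ) : ZMod M) else .inl ⟨s, h⟩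
  have hσ : ∀ q, ι (σ q) = φ.state (ι q) := by
    rintro (s | a)
    · rfl
    · exact hγsucc a
  have hF : ∀ e, F (φ.edge e) = σ (F e) := by
    intro e
    have htg := φ.tgt_edge e
    by_cases h : A.tgt e ∈ Set.range γ
    · have h' : A.tgt (φ.edge e) ∈ Set.range γ := by rwa [htg, hmem]
      simp only [F, dif_pos h, dif_pos h', (hT e (hcyc e h)).1]
      rfl
    · have h' : A.tgt (φ.edge e) ∉ Set.range γ := by rwa [htg, hmem]
      simp only [F, dif_neg h, dif_neg h']
      exact congrArg Sum.inl (Subtype.ext htg)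
  have hιF : ∀ e, ι (F e) = A.tgt e := by
    intro e
    by_cases h : A.tgt e ∈ Set.range γ
    · simp only [F, dif_pos h]
      exact hγT e h
    · simp only [F, dif_neg h]
      rfl
  have hj : ∀ l, l < r → j (φ.state^[l] t) = .inr (l : ZMod M) := by
    intro l hl
    have h : φ.state^[l] t ∈ Set.range γ := ⟨l, hγnat l⟩
    simp only [j, dif_pos h]
    congr 2
    exact hinj _ _ (Nat.mod_lt _ hrpos) hl ((hmod _).trans h.choose_spec)
  have hj' : ∀ s (hs : s ∉ Set.range γ), j s = .inl ⟨s, hs⟩ := fun s hs => dif_neg hs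
  have hγlt : ∀ a, ∃ l, l < r ∧ γ a = φ.state^[l] t := fun a =>
    ⟨a.val % r, Nat.mod_lt _ hrpos, (hmod _).symm⟩
  have hιj : ∀ s, ι (j s) = s := by
    intro s
    by_cases h : s ∈ Set.range γ
    · obtain ⟨a, rfl⟩ := h
      obtain ⟨l, hl, hla⟩ := hγlt a
      rw [hla, hj l hl]
      exact hγnat l
    · rw [hj' s h]
      rfl
  have hjt : j t = .inr 0 := by simpa using hj 0 hrpos
  have hσit : ∀ l : ℕ, σ^[l] (j t) = .inr (l : ZMod M) := by
    intro l
    induction l with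
    | zero => simpa using hjt
    | succ l ih =>
      rw [Function.iterate_succ_apply', ih, Nat.cast_succ]
      rfl
  refine ⟨coverAutomaton ι F, coverAut φ σ hσ hF, j, ι, ?_⟩
  constructor
  · exact hιj
  · intro l hl
    exact (hσit l).trans (hj l hl).symm
  · rintro l hl hlM ⟨s, hs⟩
    have hs' : j s = .inr (l : ZMod M) := hs.trans (hσit l)
    by_cases h : s ∈ Set.range γ
    · obtain ⟨a, rfl⟩ := h
      obtain ⟨k, hk, hka⟩ := hγlt a
      rw [hka, hj k hk, Sum.inr.injEq] at hs'
      have := congrArg ZMod.val hs'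
      rw [ZMod.val_natCast_of_lt (hk.trans_le hrM), ZMod.val_natCast_of_lt hlM] at this
      exact absurd hl (by rw [← this]; exact not_le.2 hk)
    · rw [hj' s h] at hs'
      exact Sum.inl_ne_inr hs'
  · refine Nat.dvd_antisymm ?_ ?_
    · refine (Automaton.DigraphAut.stateOrbit_dvd_iff _).2 ((hσit M).trans ?_)
      rw [hjt, ZMod.natCast_self]
    · have h := (Automaton.DigraphAut.stateOrbit_dvd_iff (coverAut φ σ hσ hF) (q := j t)).1 dvd_rfl
      have h1 := (hσit _).symm.trans (h.trans hjt)
      exact (ZMod.natCast_eq_zero_iff _ _).1 (Sum.inr.inj h1)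
  · rintro (s | a)
    · exact Or.inl ⟨s, hj' s s.2⟩
    · have ha : ((a.val : ℕ) : ZMod M) = a := ZMod.natCast_zmod_val a
      by_cases hlt : a.val < r
      · exact Or.inl ⟨_, (hj _ hlt).trans (congrArg Sum.inr ha)⟩
      · refine Or.inr ⟨a.val, not_lt.1 hlt, ZMod.val_lt a, ?_⟩
        exact (congrArg Sum.inr ha).symm.trans (hσit a.val).symm
  · intro x s hs
    have h : A.trans x s ∉ Set.range γ := by
      rintro ⟨a, ha⟩
      exact hs _ ha.symm
    change F (ι (j s), x) = j (A.trans x s)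
    rw [hιj, hj' _ h]
    exact dif_neg h
  · intro x q
    change F (ι q, x) = F (ι (j (ι q)), x)
    rw [hιj]
  · exact fun x q => hιF (ι q, x)
  · exact hσ
  · intro e
    exact Prod.ext ((hσ e.1).trans (φ.src_edge (ι e.1, e.2)).symm) rfl
-- Invariants of a splitting step
open Automaton

variable {n N : ℕ}

/-- All circuits are on orbits of length `N`. -/
def HasCircuitOrbits (N : ℕ) {A : Automaton n} (φ : A.DigraphAut) : Prop :=
  ∀ (k : ℕ) (c : Fin (k + 1) → A.Edge), A.IsCircuit c → φ.seqOrbit c = N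

namespace HasCircuitOrbits

variable {A : Automaton n} {φ : A.DigraphAut}

theorem edgeOrbit_dvd (h : HasCircuitOrbits N φ) (hA : A.IsCore) (e : A.Edge) :
    φ.edgeOrbit e ∣ N := by
  obtain ⟨k, c, hc, rfl⟩ := hA.exists_circuit e
  exact φ.seqOrbit_dvd_iff.1 (h k c hc).dvd 0

theorem pos (h : HasCircuitOrbits N φ) (hA : A.IsCore) (e : A.Edge) : 0 < N := by
  obtain ⟨k, c, hc, -⟩ := hA.exists_circuit e
  exact h k c hc ▸ φ.seqOrbit_pos c

end HasCircuitOrbits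

section Step

variable {A B : Automaton n} {φ : A.DigraphAut} {t : A.State} {M : ℕ}
  {ψ : B.DigraphAut} {j : A.State → B.State} {ι : B.State → A.State}

namespace IsInSplit

theorem edgeOrbit_proj_dvd (h : IsInSplit φ t M ψ j ι) (e : B.Edge) :
    φ.edgeOrbit (ι e.1, e.2) ∣ ψ.edgeOrbit e := by
  rw [h.edgeOrbit_eq]
  exact Nat.dvd_lcm_right _ _

theorem edgeOrbit_dvd (h : IsInSplit φ t M ψ j ι) (hM : M ∣ N)
    (hN : ∀ e, φ.edgeOrbit e ∣ N) (e : B.Edge) : ψ.edgeOrbit e ∣ N := by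
  rw [h.edgeOrbit_eq]
  refine Nat.lcm_dvd ?_ (hN _)
  rcases h.stateOrbit_cases e.1 with he | ⟨-, -, he⟩
  · rwa [he]
  · rw [he]
    exact (φ.stateOrbit_src_dvd (ι e.1, e.2)).trans (hN _)

/-- A circuit projects to a circuit whose orbit length `N` divides that of the original; conversely
all edge orbit lengths upstairs still divide `N`. -/
theorem hasCircuitOrbits (h : IsInSplit φ t M ψ j ι) (hA : A.IsCore) (hM : M ∣ N)
    (hN : HasCircuitOrbits N φ) : HasCircuitOrbits N ψ := by
  intro k c hc
  refine Nat.dvd_antisymm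
    (ψ.seqOrbit_dvd_iff.2 fun i => h.edgeOrbit_dvd hM (hN.edgeOrbit_dvd hA) _) ?_
  rw [← hN k (fun i => (ι (c i).1, (c i).2)), φ.seqOrbit_dvd_iff]
  · exact fun i => (h.edgeOrbit_proj_dvd _).trans (ψ.seqOrbit_dvd_iff.1 dvd_rfl i)
  · exact fun i => (h.proj_trans _ _).symm.trans (congrArg ι (hc i))

end IsInSplit

/-- Splitting along the orbit of a heavy state, with the invariants that it preserves. -/
theorem exists_addsShadowStates (hn : 0 < n) {H : Transducer n} (hA : IsSupport H A φ)
    (hN : HasCircuitOrbits N φ) (hpos : 0 < N) {b : ℕ} (hb : IsDivisibilityConstant φ N t b)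
    (hM : IsValidSplittingLength φ N t b M) :
    ∃ (B : Automaton n) (ψ : B.DigraphAut) (j : A.State → B.State) (ι : B.State → A.State),
      IsInSplit φ t M ψ j ι ∧ AddsShadowStates N ⟨A, φ⟩ ⟨B, ψ⟩ ∧ IsSupport H B ψ ∧
      HasCircuitOrbits N ψ := by
  have hMN : M ∣ N := hM.2.1 ▸ Nat.dvd_lcm_left M b
  obtain ⟨m, -, hm⟩ := hM.2.2
  obtain ⟨B, ψ, j, ι, h⟩ := exists_isInSplit φ t (Nat.pos_of_dvd_of_pos hMN hpos)
    (hm ▸ Nat.dvd_mul_left _ _) hM.1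
  exact ⟨B, ψ, j, ι, h, ⟨t, b, M, j, ι, hb, hM, h⟩, h.isSupport hn hA,
    h.hasCircuitOrbits hA.1 hMN hN⟩

end Step

/-! ### Heavy states from a prime divisor of `N` -/

theorem lcm_div_prime {p ℓ : ℕ} (hpos : 0 < N) (hp : p.Prime) (hpN : p ∣ N) (h1 : ℓ ∣ N)
    (h2 : ¬ ℓ ∣ N / p) : Nat.lcm (N / p) ℓ = N := by
  obtain ⟨b, rfl⟩ := hpN
  rw [Nat.mul_div_cancel_left _ hp.pos] at h2 ⊢
  have hb : 0 < b := Nat.pos_of_mul_pos_left hpos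
  obtain ⟨d, hd⟩ := Nat.dvd_lcm_left b ℓ
  have h3 : b * d ∣ b * p := by
    rw [← hd, mul_comm b p]
    exact Nat.lcm_dvd (Nat.dvd_mul_left _ _) h1
  rcases (Nat.dvd_prime hp).1 (Nat.dvd_of_mul_dvd_mul_left hb h3) with rfl | rfl
  · rw [mul_one] at hd
    exact absurd (hd ▸ Nat.dvd_lcm_right b ℓ) h2
  · rw [hd, mul_comm]

/-- The cofactor of `ℓ` in `N` is prime to `p`, so `ℓ` carries the full power of `p`. -/
theorem ordProj_dvd_of_not_dvd_div {p ℓ : ℕ} (hp : p.Prime) (h1 : ℓ ∣ N)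
    (h2 : ¬ ℓ ∣ N / p) : p ^ N.factorization p ∣ ℓ := by
  obtain ⟨k, rfl⟩ := h1
  have hk : ¬ p ∣ k := by
    rintro ⟨k, rfl⟩
    refine h2 ?_
    rw [mul_left_comm, Nat.mul_div_cancel_left _ hp.pos]
    exact Nat.dvd_mul_right _ _
  exact (((Nat.Prime.coprime_iff_not_dvd hp).2 hk).pow_left _).dvd_of_dvd_mul_right
    (Nat.ordProj_dvd _ p)

/-- A state from which an edge with orbit length dividing `N / p` starts, but into which no such
edge goes, is heavy. -/
theorem isHeavy_of_src {A : Automaton n} {φ : A.DigraphAut} {p : ℕ} (hp : p ∈ N.primeFactors)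
    (hN : ∀ e, φ.edgeOrbit e ∣ N) {e : A.Edge} (he : φ.edgeOrbit e ∣ N / p)
    (hpred : ∀ e', A.tgt e' = A.src e → ¬ φ.edgeOrbit e' ∣ N / p) :
    ∃ M, IsDivisibilityConstant φ N (A.src e) (N / p) ∧
      IsValidSplittingLength φ N (A.src e) (N / p) M ∧ ¬ M ∣ N / p := by
  obtain ⟨hp, hpN, hN0⟩ := Nat.mem_primeFactors.1 hp
  have hpos := Nat.pos_of_ne_zero hN0
  have hr := (φ.stateOrbit_src_dvd e).trans he
  have hdvd : ¬ p ^ N.factorization p ∣ N / p := by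
    rw [hp.pow_dvd_iff_le_factorization (Nat.div_pos (Nat.le_of_dvd hpos hpN) hp.pos).ne',
      Nat.factorization_div hpN]
    have := hp.factorization_pos_of_dvd hN0 hpN
    simp [hp.factorization]
    omega
  have hM : ¬ Nat.lcm (φ.stateOrbit (A.src e)) (p ^ N.factorization p) ∣ N / p :=
    fun h => hdvd ((Nat.dvd_lcm_right _ _).trans h)
  -- The least multiple of the orbit length that contains the full power of `p`: this keeps it from
  -- dividing `N / p`, yet it still divides the length of each incoming edge.
  refine ⟨Nat.lcm (φ.stateOrbit (A.src e)) (p ^ N.factorization p), ⟨?_, hr, ?_⟩,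
    ⟨?_, ?_, ?_⟩, hM⟩
  · exact Nat.mem_properDivisors.2 ⟨Nat.div_dvd_of_dvd hpN, Nat.div_lt_self hpos hp.one_lt⟩
  · exact fun e' he' => lcm_div_prime hpos hp hpN (hN e') (hpred e' he')
  · intro e' he'
    exact Nat.lcm_dvd (he' ▸ φ.stateOrbit_tgt_dvd e')
      (ordProj_dvd_of_not_dvd_div hp (hN e') (hpred e' he'))
  · rw [Nat.lcm_comm]
    exact lcm_div_prime hpos hp hpN (Nat.lcm_dvd (hr.trans (Nat.div_dvd_of_dvd hpN))
      (Nat.ordProj_dvd _ _)) hM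
  · obtain ⟨m, hm⟩ := Nat.dvd_lcm_left (φ.stateOrbit (A.src e)) (p ^ N.factorization p)
    refine ⟨m, ?_, by rw [hm, mul_comm]⟩
    by_contra! hlt
    interval_cases m
    · exact (Nat.lcm_pos (φ.stateOrbit_pos _) (Nat.pow_pos hp.pos)).ne' hm
    · exact hM (by rw [hm, mul_one]; exact hr)

/-! ### Iterated splitting -/

/-- Shadow states can be added until no edge has an orbit length dividing `N / p`. -/
theorem exists_forall_not_edgeOrbit_dvd_div (hn : 0 < n) {H : Transducer n} {p : ℕ}
    (hp : p ∈ N.primeFactors) (A : Automaton n) (φ : A.DigraphAut) (hA : IsSupport H A φ)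
    (hN : HasCircuitOrbits N φ) :
    ∃ (B : Automaton n) (ψ : B.DigraphAut),
      Relation.ReflTransGen (AddsShadowStates N) ⟨A, φ⟩ ⟨B, ψ⟩ ∧ IsSupport H B ψ ∧
      HasCircuitOrbits N ψ ∧ (∀ e, ¬ ψ.edgeOrbit e ∣ N / p) ∧
      ∀ b, (∀ e, ¬ φ.edgeOrbit e ∣ b) → ∀ e, ¬ ψ.edgeOrbit e ∣ b := by
  induction hd : {e | φ.edgeOrbit e ∣ N / p}.ncard using Nat.strong_induction_on
    generalizing A with
  | _ d ih =>
    by_cases hne : ∃ e, φ.edgeOrbit e ∣ N / p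
    · have hpos : 0 < N := Nat.pos_of_ne_zero (Nat.mem_primeFactors.1 hp).2.2
      have hproper : ¬ N ∣ N / p := Nat.not_dvd_of_pos_of_lt
        (Nat.div_pos (Nat.le_of_mem_primeFactors hp) (Nat.pos_of_mem_primeFactors hp))
        (Nat.div_lt_self hpos (Nat.prime_of_mem_primeFactors hp).one_lt)
      obtain ⟨e, he, hpred⟩ := φ.exists_edge_forall_pred hN hproper hne
      obtain ⟨M, hb, hM, hMp⟩ := isHeavy_of_src hp (hN.edgeOrbit_dvd hA.1) he hpred
      obtain ⟨B, ψ, j, ι, h, hadd, hB, hNB⟩ := exists_addsShadowStates hn hA hN hpos hb hM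
      -- An edge leaving the new orbit has length divisible by `M`, so it is not bad; a bad edge
      -- therefore starts at the original copy of a state other than the source of `e`.
      have hcases : ∀ d : B.Edge, ψ.edgeOrbit d ∣ N / p → d.1 = j (ι d.1) ∧ ι d.1 ≠ A.src e := by
        intro d hd
        rcases h.stateOrbit_cases d.1 with h1 | ⟨h1, h2, -⟩
        · exact absurd ((h1 ▸ ψ.stateOrbit_src_dvd d).trans hd) hMp
        · exact ⟨h1, h2⟩
      have hinj : Set.InjOn (fun d : B.Edge => ((ι d.1, d.2) : A.Edge))
          {d | ψ.edgeOrbit d ∣ N / p} := by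
        intro c hc d hd hcd
        obtain ⟨h1, h2⟩ := Prod.mk.inj hcd
        exact Prod.ext (by rw [(hcases c hc).1, h1, ← (hcases d hd).1]) h2
      have hlt : {d | ψ.edgeOrbit d ∣ N / p}.ncard < d := by
        rw [← hd, ← hinj.ncard_image]
        refine Set.ncard_lt_ncard ⟨?_, fun hss => ?_⟩ (Set.toFinite _)
        · rintro _ ⟨c, hc, rfl⟩
          exact (h.edgeOrbit_proj_dvd c).trans hc
        · obtain ⟨c, hc, hce⟩ := hss he
          exact (hcases c hc).2 (congrArg Prod.fst hce)
      obtain ⟨C, χ, hBC, hC, hNC, hCp, hCb⟩ := ih _ hlt B ψ hB hNB rfl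
      -- Edge orbit lengths only grow in the divisibility order, so a `b` excluded for `φ` is
      -- excluded for `ψ`.
      exact ⟨C, χ, .head hadd hBC, hC, hNC, hCp, fun b hφ => hCb b fun d hd =>
        hφ _ ((h.edgeOrbit_proj_dvd d).trans hd)⟩
    · push Not at hne
      exact ⟨A, φ, .refl, hA, hN, hne, fun _ => id⟩

/-- The primes dividing `N` are treated one at a time, which works because later splits preserve
earlier exclusions. A divisor of `N` that divides no `N / p` is `N` itself. -/
theorem exists_forall_edgeOrbit_eq (hn : 0 < n) {H : Transducer n} (A : Automaton n)
    (φ : A.DigraphAut) (hA : IsSupport H A φ) (hN : HasCircuitOrbits N φ) :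
    ∃ (B : Automaton n) (ψ : B.DigraphAut),
      Relation.ReflTransGen (AddsShadowStates N) ⟨A, φ⟩ ⟨B, ψ⟩ ∧ IsSupport H B ψ ∧
      HasCircuitOrbits N ψ ∧ ∀ e, ψ.edgeOrbit e = N := by
  have key : ∀ S ⊆ N.primeFactors, ∃ (B : Automaton n) (ψ : B.DigraphAut),
      Relation.ReflTransGen (AddsShadowStates N) ⟨A, φ⟩ ⟨B, ψ⟩ ∧ IsSupport H B ψ ∧
      HasCircuitOrbits N ψ ∧ ∀ p ∈ S, ∀ e, ¬ ψ.edgeOrbit e ∣ N / p := by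
    intro S hS
    induction S using Finset.induction_on with
    | empty => exact ⟨A, φ, .refl, hA, hN, by simp⟩
    | insert p S _ ih =>
      rw [Finset.insert_subset_iff] at hS
      obtain ⟨B, ψ, hAB, hB, hNB, hS'⟩ := ih hS.2
      obtain ⟨C, χ, hBC, hC, hNC, hCp, hCb⟩ :=
        exists_forall_not_edgeOrbit_dvd_div hn hS.1 B ψ hB hNB
      refine ⟨C, χ, hAB.trans hBC, hC, hNC, ?_⟩
      rw [Finset.forall_mem_insert]
      exact ⟨hCp, fun q hq => hCb _ (hS' q hq)⟩
  obtain ⟨B, ψ, hAB, hB, hNB, h⟩ := key _ subset_rfl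
  refine ⟨B, ψ, hAB, hB, hNB, fun e => ?_⟩
  obtain ⟨k, hk⟩ := hNB.edgeOrbit_dvd hB.1 e
  have hpos := hNB.pos hB.1 e
  by_cases hk1 : k = 1
  · rw [hk, hk1, mul_one]
  · obtain ⟨p, hp, hpk⟩ := Nat.exists_prime_and_dvd hk1
    refine absurd ?_ (h p (Nat.mem_primeFactors.2 ⟨hp, hk ▸ hpk.mul_left _, hpos.ne'⟩) e)
    obtain ⟨m, rfl⟩ := hpk
    refine ⟨m, ?_⟩
    conv_lhs => rw [hk]
    rw [mul_left_comm, Nat.mul_div_cancel_left _ hp.pos]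

/-- Each split with constant `r` and length `N` keeps all edge lengths equal to `N` and lowers the
number of states of shorter orbit, since the whole new orbit has length `N`. -/
theorem exists_forall_stateOrbit_eq (hn : 0 < n) {H : Transducer n} (A : Automaton n)
    (φ : A.DigraphAut) (hA : IsSupport H A φ) (hN : HasCircuitOrbits N φ)
    (hE : ∀ e, φ.edgeOrbit e = N) :
    ∃ (B : Automaton n) (ψ : B.DigraphAut),
      Relation.ReflTransGen (AddsShadowStates N) ⟨A, φ⟩ ⟨B, ψ⟩ ∧ IsSupport H B ψ ∧
      (∀ e, ψ.edgeOrbit e = N) ∧ ∀ q, ψ.stateOrbit q = N := by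
  induction hd : {q | φ.stateOrbit q ≠ N}.ncard using Nat.strong_induction_on
    generalizing A with
  | _ d ih =>
    by_cases hne : ∃ t, φ.stateOrbit t ≠ N
    · obtain ⟨t, ht⟩ := hne
      have hr : φ.stateOrbit t ∣ N := hE (t, ⟨0, hn⟩) ▸ φ.stateOrbit_src_dvd (t, ⟨0, hn⟩)
      have hpos : 0 < N := hN.pos hA.1 (t, ⟨0, hn⟩)
      have hb : IsDivisibilityConstant φ N t (φ.stateOrbit t) :=
        ⟨Nat.mem_properDivisors.2 ⟨hr, lt_of_le_of_ne (Nat.le_of_dvd hpos hr) ht⟩, dvd_rfl,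
          fun e _ => by rw [hE e, Nat.lcm_eq_right hr]⟩
      have hM : IsValidSplittingLength φ N t (φ.stateOrbit t) N := by
        refine ⟨fun e _ => (hE e).symm.dvd, Nat.lcm_eq_left hr, ?_⟩
        obtain ⟨m, hm⟩ := hr
        refine ⟨m, ?_, by rw [mul_comm]; exact hm⟩
        by_contra! hlt
        interval_cases m
        · exact hpos.ne' hm
        · exact ht (by rw [hm, mul_one])
      obtain ⟨B, ψ, j, ι, h, hadd, hB, hNB⟩ := exists_addsShadowStates hn hA hN hpos hb hM
      have hEB : ∀ e, ψ.edgeOrbit e = N := fun e =>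
        Nat.dvd_antisymm (hNB.edgeOrbit_dvd hB.1 e) (hE (ι e.1, e.2) ▸ h.edgeOrbit_proj_dvd e)
      have hcases : ∀ q, ψ.stateOrbit q ≠ N →
          q = j (ι q) ∧ ι q ≠ t ∧ ψ.stateOrbit q = φ.stateOrbit (ι q) :=
        fun q hq => (h.stateOrbit_cases q).resolve_left hq
      have hinj : Set.InjOn ι {q | ψ.stateOrbit q ≠ N} := by
        intro q hq s hs hqs
        rw [(hcases q hq).1, hqs, ← (hcases s hs).1]
      have hlt : {q | ψ.stateOrbit q ≠ N}.ncard < d := by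
        rw [← hd, ← hinj.ncard_image]
        refine Set.ncard_lt_ncard ⟨?_, fun hss => ?_⟩ (Set.toFinite _)
        · rintro _ ⟨q, hq, rfl⟩
          exact fun hqN => hq ((hcases q hq).2.2.trans hqN)
        · obtain ⟨q, hq, hqt⟩ := hss ht
          exact (hcases q hq).2.1 hqt
      obtain ⟨C, χ, hBC, hC⟩ := ih _ hlt B ψ hB hNB hEB rfl
      exact ⟨C, χ, .head hadd hBC, hC⟩
    · push Not at hne
      exact ⟨A, φ, .refl, hA, hE, hne⟩

end ShiftAutomata

open ShiftAutomata
theorem lemma4p11 (n : ℕ) (hn : 0 < n) (N : ℕ)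
    (H : Transducer n) (hH : H ∈ Hn n)
    (A : Automaton n) (φ : A.DigraphAut) (hA : IsSupport H A φ)
    (hcirc : ∀ (k : ℕ) (c : Fin (k + 1) → A.Edge), A.IsCircuit c → φ.seqOrbit c = N) :
    (∃ (B : Automaton n) (ψ : B.DigraphAut),
      Relation.ReflTransGen (AddsShadowStates N) ⟨A, φ⟩ ⟨B, ψ⟩ ∧
      IsSupport H B ψ ∧
      ∀ e : B.Edge, ψ.edgeOrbit e = N) ∧
    (∃ (B : Automaton n) (ψ : B.DigraphAut),
      Relation.ReflTransGen (AddsShadowStates N) ⟨A, φ⟩ ⟨B, ψ⟩ ∧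
      IsSupport H B ψ ∧
      (∀ e : B.Edge, ψ.edgeOrbit e = N) ∧
      ∀ q : B.State, ψ.stateOrbit q = N) := by
  obtain ⟨B, ψ, hAB, hB, hNB, hE⟩ := exists_forall_edgeOrbit_eq hn A φ hA hcirc
  obtain ⟨C, χ, hBC, hC, hEC, hSC⟩ := exists_forall_stateOrbit_eq hn B ψ hB hNB hE
  exact ⟨⟨B, ψ, hAB, hB, hE⟩, C, χ, hAB.trans hBC, hC, hEC, hSC⟩
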